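/- Let $T$ and $D$ be the unitary operators on $L^2(\mathbb R)$ (complex-valued functions) given by $[Tf](x)=f(x-1)$ and $[Df](x)=2^{1/2}f(2x)$. For $\psi\in L^2(\mathbb R)$ and $k,j\in\mathbb Z$ put $\psi_{k,j}:=D^kT^j\psi$, and for $B>0$ say that the wavelet system $\{\psi_{k,j}\}_{k,j\in\mathbb Z}$ is a tight frame for $L^2(\mathbb R)$ with frame bound $B$ if $$\sum_{k,j\in\mathbb Z}|\langle f,\psi_{k,j}\rangle|^2=B\,\|f\|^2\qquad\text{for all } f\in L^2(\mathbb R).$$ Let $\psi\in L^2[0,1]$, i.e. $\psi\in L^2(\mathbb R)$ and $\psi=0$ a.e. outside $[0,1]$, and let $B>0$. Then $\{\psi_{k,j}\}$ is a tight frame for $L^2(\mathbb R)$ with frame bound $B$ if and only if, as elements of $L^2(\mathbb R)$, $$\psi=\beta\,[\chi_{[0,1/2)}-\chi_{[1/2,1)}]\qquad\text{for some }\beta\in\mathbb C\text{ with }|\beta|^2=B.$$ In particular, up to a constant factor of modulus one, the Haar wavelet is the only orthonormal wavelet supported in $[0,1]$: for $\psi\in L^2[0,1]$, the family $\{\psi_{k,j}\}_{k,j\in\mathbb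 Z}$ is an orthonormal basis of $L^2(\mathbb R)$ if and only if $\psi=\beta\,[\chi_{[0,1/2)}-\chi_{[1/2,1)}]$ for some $\beta\in\mathbb C$ with $|\beta|=1$. -/

import Mathlib

open MeasureTheory

namespace DyadicWavelet

/-- The complex Hilbert space `L²(ℝ)` with respect to Lebesgue measure. -/
abbrev L2R : Type := Lp ℂ 2 (volume : Measure ℝ)

/-- `x ↦ x + a` preserves Lebesgue measure. -/
theorem measurePreserving_shift (a : ℝ) :
    MeasurePreserving (fun x : ℝ => x + a) volume volume :=
  measurePreserving_add_right volume a

/-- The unitary translation operator `[T f](x) = f (x - 1)` on `L²(ℝ)`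
(see `coeFn_translation`). -/
noncomputable def translation : L2R ≃ₗᵢ[ℂ] L2R where
  toFun f := Lp.compMeasurePreserving (fun x : ℝ => x + (-1)) (measurePreserving_shift (-1)) f
  invFun f := Lp.compMeasurePreserving (fun x : ℝ => x + 1) (measurePreserving_shift 1) f
  map_add' f g := map_add _ f g
  map_smul' c f := (Lp.compMeasurePreservingₗ ℂ _ (measurePreserving_shift (-1))).map_smul c f
  left_inv f := by
    apply Lp.ext
    have h1 := Lp.coeFn_compMeasurePreserving
      (Lp.compMeasurePreserving (fun x : ℝ => x + (-1)) (measurePreserving_shift (-1)) f)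
      (measurePreserving_shift 1)
    have h2 := (measurePreserving_shift 1).quasiMeasurePreserving.ae_eq_comp
      (Lp.coeFn_compMeasurePreserving f (measurePreserving_shift (-1)))
    filter_upwards [h1, h2] with x hx1 hx2
    rw [hx1, hx2]
    simp
  right_inv f := by
    apply Lp.ext
    have h1 := Lp.coeFn_compMeasurePreserving
      (Lp.compMeasurePreserving (fun x : ℝ => x + 1) (measurePreserving_shift 1) f)
      (measurePreserving_shift (-1))
    have h2 := (measurePreserving_shift (-1)).quasiMeasurePreserving.ae_eq_comp
      (Lp.coeFn_compMeasurePreserving f (measurePreserving_shift 1))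
    filter_upwards [h1, h2] with x hx1 hx2
    rw [hx1, hx2]
    simp
  norm_map' f := Lp.norm_compMeasurePreserving f (measurePreserving_shift (-1))

theorem coeFn_translation (f : L2R) : translation f =ᵐ[volume] fun x => f (x - 1) := by
  filter_upwards [Lp.coeFn_compMeasurePreserving f (measurePreserving_shift (-1))] with x hx
  exact hx

/-- Scaling the variable by `c > 0` maps null sets to null sets. -/
theorem quasiMeasurePreserving_scale {c : ℝ} (hc : 0 < c) :
    Measure.QuasiMeasurePreserving (fun x : ℝ => c * x) volume volume := by
  refine ⟨by fun_prop, ?_⟩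
  rw [Real.map_volume_mul_left hc.ne']
  exact Measure.smul_absolutelyContinuous

theorem eLpNorm_scale {c : ℝ} (hc : 0 < c) (f : L2R) :
    eLpNorm (fun x : ℝ => ((√c : ℝ) : ℂ) * f (c * x)) 2 volume = eLpNorm f 2 volume := by
  have hq := quasiMeasurePreserving_scale hc
  have h1 : eLpNorm (fun x : ℝ => f (c * x)) 2 volume
      = eLpNorm f 2 (Measure.map (fun x : ℝ => c * x) volume) :=
    (eLpNorm_map_measure ((Lp.aestronglyMeasurable f).mono_ac hq.absolutelyContinuous)
      hq.measurable.aemeasurable).symm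
  have h2 : (fun x : ℝ => ((√c : ℝ) : ℂ) * f (c * x))
      = ((√c : ℝ) : ℂ) • fun x : ℝ => f (c * x) := rfl
  rw [h2, eLpNorm_const_smul, h1, Real.map_volume_mul_left hc.ne',
    eLpNorm_smul_measure_of_ne_top (by simp), smul_eq_mul, ← mul_assoc]
  have h3 : ‖((√c : ℝ) : ℂ)‖ₑ = ENNReal.ofReal c ^ (1 / 2 : ℝ) := by
    rw [ENNReal.ofReal_rpow_of_pos hc, ← Real.sqrt_eq_rpow, ← ofReal_norm]
    simp [abs_of_nonneg (Real.sqrt_nonneg c)]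
  have h4 : (1 / (2 : ENNReal)).toReal = (1 / 2 : ℝ) := by simp
  rw [h3, h4, ← ENNReal.mul_rpow_of_nonneg _ _ (by norm_num), ← ENNReal.ofReal_mul hc.le,
    abs_of_pos (inv_pos.2 hc), mul_inv_cancel₀ hc.ne']
  simp

theorem memLp_scale {c : ℝ} (hc : 0 < c) (f : L2R) :
    MemLp (fun x : ℝ => ((√c : ℝ) : ℂ) * f (c * x)) 2 volume := by
  refine ⟨?_, ?_⟩
  · exact ((Lp.aestronglyMeasurable f).comp_quasiMeasurePreserving
      (quasiMeasurePreserving_scale hc)).const_mul _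
  · rw [eLpNorm_scale hc]
    exact Lp.eLpNorm_lt_top f

/-- The element `x ↦ √c f (c x)` of `L²(ℝ)`, for `c > 0`. -/
noncomputable def scale {c : ℝ} (hc : 0 < c) (f : L2R) : L2R := (memLp_scale hc f).toLp _

theorem coeFn_scale {c : ℝ} (hc : 0 < c) (f : L2R) :
    scale hc f =ᵐ[volume] fun x => ((√c : ℝ) : ℂ) * f (c * x) :=
  MemLp.coeFn_toLp _

theorem scale_scale {c d : ℝ} (hc : 0 < c) (hd : 0 < d) (hcd : c * d = 1) (f : L2R) :
    scale hc (scale hd f) = f := by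
  apply Lp.ext
  filter_upwards [coeFn_scale hc (scale hd f),
    (quasiMeasurePreserving_scale hc).ae_eq_comp (coeFn_scale hd f)] with x h1 h2
  simp only [Function.comp_apply] at h2
  rw [h1, h2, ← mul_assoc, ← mul_assoc, ← Complex.ofReal_mul, ← Real.sqrt_mul hc.le, hcd,
    mul_comm d c, hcd]
  simp

/-- The unitary dyadic dilation operator `[D f](x) = 2^{1/2} f (2 x)` on `L²(ℝ)`
(see `coeFn_dilation`). -/
noncomputable def dilation : L2R ≃ₗᵢ[ℂ] L2R where
  toFun f := scale (c := 2) (by norm_num) f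
  invFun f := scale (c := 2⁻¹) (by norm_num) f
  map_add' f g := by
    have h0 : (0 : ℝ) < 2 := by norm_num
    apply Lp.ext
    filter_upwards [coeFn_scale h0 (f + g), coeFn_scale h0 f, coeFn_scale h0 g,
      Lp.coeFn_add (scale h0 f) (scale h0 g),
      (quasiMeasurePreserving_scale h0).ae_eq_comp (Lp.coeFn_add f g)] with x h1 h2 h3 h4 h5
    simp only [Function.comp_apply, Pi.add_apply] at h4 h5
    rw [h1, h4, h2, h3, h5, mul_add]
  map_smul' a f := by
    have h0 : (0 : ℝ) < 2 := by norm_num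
    apply Lp.ext
    filter_upwards [coeFn_scale h0 (a • f), coeFn_scale h0 f,
      Lp.coeFn_smul a (scale h0 f),
      (quasiMeasurePreserving_scale h0).ae_eq_comp (Lp.coeFn_smul a f)] with x h1 h2 h3 h4
    simp only [Function.comp_apply, Pi.smul_apply, smul_eq_mul] at h3 h4
    rw [RingHom.id_apply, h1, h3, h2, h4, mul_left_comm]
  left_inv f := scale_scale (by norm_num) (by norm_num) (by norm_num) f
  right_inv f := scale_scale (by norm_num) (by norm_num) (by norm_num) f
  norm_map' f := by
    have h0 : (0 : ℝ) < 2 := by norm_num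
    change ‖scale h0 f‖ = ‖f‖
    rw [scale, Lp.norm_toLp, eLpNorm_scale h0, Lp.norm_def]

theorem coeFn_dilation (f : L2R) :
    dilation f =ᵐ[volume] fun x => ((√2 : ℝ) : ℂ) * f (2 * x) :=
  coeFn_scale (by norm_num) f

/-- The element `ψ_{k,j} = D^k T^j ψ`, `k, j ∈ ℤ`, of the wavelet system generated by `ψ`; the
integer powers are taken in the group of unitary operators on `L²(ℝ)`. -/
noncomputable def waveletElement (ψ : L2R) (k j : ℤ) : L2R :=
  (dilation ^ k) ((translation ^ j) ψ)

/-- The wavelet system generated by `Ψ` is a frame for `L²(ℝ)` with bounds `A, B > 0`: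
`A ‖f‖² ≤ ∑_{ψ ∈ Ψ} ∑_{k, j ∈ ℤ} |⟨f, ψ_{k,j}⟩|² ≤ B ‖f‖²` for all `f`, the sum of nonnegative
terms being taken in `[0, ∞]`. -/
def IsWaveletFrame (Ψ : Set L2R) (A B : ℝ) : Prop :=
  0 < A ∧ 0 < B ∧ ∀ f : L2R,
    ENNReal.ofReal (A * ‖f‖ ^ 2) ≤
      ∑' ψ : Ψ, ∑' k : ℤ, ∑' j : ℤ,
        ENNReal.ofReal (‖inner ℂ (waveletElement (ψ : L2R) k j) f‖ ^ 2) ∧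
    ∑' ψ : Ψ, ∑' k : ℤ, ∑' j : ℤ,
        ENNReal.ofReal (‖inner ℂ (waveletElement (ψ : L2R) k j) f‖ ^ 2) ≤
      ENNReal.ofReal (B * ‖f‖ ^ 2)

/-- The wavelet system generated by `Ψ` is a tight frame for `L²(ℝ)` with frame bound `B`. -/
def IsTightWaveletFrame (Ψ : Set L2R) (B : ℝ) : Prop := IsWaveletFrame Ψ B B

/-- `ψ` is an orthonormal wavelet: `{D^k T^j ψ}` is an orthonormal basis of `L²(ℝ)`, that is,
an orthonormal family with dense linear span. -/
def IsOrthonormalWavelet (ψ : L2R) : Prop :=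
  Orthonormal ℂ (fun p : ℤ × ℤ => waveletElement ψ p.1 p.2) ∧
    (Submodule.span ℂ (Set.range fun p : ℤ × ℤ => waveletElement ψ p.1 p.2)).topologicalClosure
      = ⊤

/-- `L²[0,1]` inside `L²(ℝ)`: the elements that vanish almost everywhere outside `[0,1]`. -/
def L2UnitInterval : Set L2R := {ψ | ∀ᵐ x : ℝ, x ∉ Set.Icc (0 : ℝ) 1 → ψ x = 0}

/-- The Haar wavelet `χ_{[0,1/2)} - χ_{[1/2,1)}` as an element of `L²(ℝ)`. -/
noncomputable def haarWavelet : L2R :=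
  indicatorConstLp 2 (measurableSet_Ico (a := (0 : ℝ)) (b := 1 / 2)) (by simp) (1 : ℂ) -
    indicatorConstLp 2 (measurableSet_Ico (a := (1 / 2 : ℝ)) (b := 1)) (by simp) (1 : ℂ)

end DyadicWavelet

/-! Split the frame sum of `f` into `fine` (scales `k ≥ 0`) and `coarse` (scales `k < 0`). At a fine
scale every wavelet lives in one integer cell, so `fine` is invariant under `T` and additive over
the cells `[0,1]` and `[1,2]`. So is `‖f‖²`; tightness therefore forces the same on `coarse`.
Rescaling by `D` turns this into `coarse f₀ + coarse f₁ = coarse f + |⟨ψ, f⟩|²`, where `f₀`, `f₁`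
are the rescaled halves of `f` (`coarse_add_coarse`).

On `K` the coarse form is `Q = ∑ |⟨uₙ, ·⟩|²` with `∑ ‖uₙ‖² ≤ ‖ψ‖²`. The identity says that two
copies of `Q`, one per half, equal `Q` plus the rank-one form of `ψ`. Squared Hilbert–Schmidt norms
give `2‖Q‖² = ‖Q‖² + 2 Q(ψ) + ‖ψ‖⁴`, whereas `‖Q‖² ≤ (∑ ‖uₙ‖²)² ≤ ‖ψ‖⁴`. Hence `Q(ψ) = 0` and
Cauchy–Schwarz is an equality throughout: `Q` is given by a single vector `u`
(`exists_coarse_eq_zero`).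

The identity then shows that the halves of `u` and of `ψ` are multiples of `u`, and `u ⊥ ψ`
(`exists_selfSimilar`). A self-similar vector is a multiple of `χ` (`exists_eq_smul_χ`, by testing
against the Haar basis), so `ψ` is constant on each half with mean zero: a multiple of the Haar
vector. Conversely the Haar system is an orthonormal basis, hence tight with bound one, and an
orthonormal basis is always such a tight frame. -/

open scoped ENNReal InnerProductSpace

/-! ### Squared norms and sums in `[0, ∞]` -/

section EnormSq

variable {E : Type*} [NormedAddCommGroup E] [InnerProductSpace ℂ E]

theorem enorm_sq_eq_ofReal_norm_sq {F : Type*} [NormedAddCommGroup F] (x : F) :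
    ‖x‖ₑ ^ 2 = ENNReal.ofReal (‖x‖ ^ 2) := by
  rw [ENNReal.ofReal_pow (norm_nonneg x), ofReal_norm]

theorem enorm_inner_comm (x y : E) : ‖inner ℂ x y‖ₑ = ‖inner ℂ y x‖ₑ := by
  rw [← ofReal_norm, ← ofReal_norm, norm_inner_symm]

theorem enorm_inner_le (x y : E) : ‖inner ℂ x y‖ₑ ≤ ‖x‖ₑ * ‖y‖ₑ := by
  rw [← ofReal_norm, ← ofReal_norm, ← ofReal_norm, ← ENNReal.ofReal_mul (norm_nonneg x)]
  exact ENNReal.ofReal_le_ofReal (norm_inner_le_norm x y)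

theorem enorm_inner_self (x : E) : ‖inner ℂ x x‖ₑ = ‖x‖ₑ ^ 2 := by
  rw [enorm_sq_eq_ofReal_norm_sq, ← ofReal_norm, inner_self_eq_norm_sq_to_K]
  simp

theorem enorm_sq_add_of_inner_eq_zero {x y : E} (h : inner ℂ x y = 0) :
    ‖x + y‖ₑ ^ 2 = ‖x‖ₑ ^ 2 + ‖y‖ₑ ^ 2 := by
  simp only [enorm_sq_eq_ofReal_norm_sq]
  rw [← ENNReal.ofReal_add (by positivity) (by positivity)]
  congr 1
  have := norm_add_sq (𝕜 := ℂ) x y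
  simpa [h] using this

theorem enorm_sq_ne_top {F : Type*} [NormedAddCommGroup F] (x : F) : ‖x‖ₑ ^ 2 ≠ ∞ := by
  rw [enorm_sq_eq_ofReal_norm_sq]
  exact ENNReal.ofReal_ne_top

end EnormSq

/-- One strict inequality would make the sums strictly ordered. This later extracts termwise
equality in Cauchy–Schwarz from equality of two double sums. -/
theorem ENNReal.eq_of_le_of_tsum_le {ι : Type*} {f g : ι → ℝ≥0∞} (hle : ∀ i, f i ≤ g i)
    (hf : ∑' i, f i ≠ ∞) (h : ∑' i, g i ≤ ∑' i, f i) (i : ι) : f i = g i := by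
  by_contra hne
  exact absurd (ENNReal.tsum_lt_tsum hf hle (lt_of_le_of_ne (hle i) hne)) (not_lt.2 h)

theorem ENNReal.tsum_int_eq (f : ℤ → ℝ≥0∞) :
    ∑' k : ℤ, f k = ∑' n : ℕ, f n + ∑' n : ℕ, f (-(n + 1 : ℕ)) := by
  rw [tsum_of_nat_of_neg_add_one ENNReal.summable ENNReal.summable]
  simp

/-- A Hilbert space with a dilation `D` and a translation `T`, a subspace `K` (the vectors
supported in the unit interval), and a unit vector `χ` of `K` satisfying the refinement equation
of the indicator function of the unit interval. -/
structure DyadicSystem (H : Type*) [NormedAddCommGroup H] [InnerProductSpace ℂ H] where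
  D : H ≃ₗᵢ[ℂ] H
  T : H ≃ₗᵢ[ℂ] H
  K : Submodule ℂ H
  χ : H
  T_D : ∀ f, T (D f) = D (T (T f))
  D_mem : ∀ f ∈ K, D f ∈ K
  D_T_mem : ∀ f ∈ K, D (T f) ∈ K
  inner_zpow_T : ∀ j : ℤ, j ≠ 0 → ∀ f ∈ K, ∀ g ∈ K, inner ℂ ((T ^ j) f) g = 0
  exists_eq_add : ∀ f ∈ K, ∃ f₀ ∈ K, ∃ f₁ ∈ K, f = D f₀ + D (T f₁)
  χ_mem : χ ∈ K
  norm_χ : ‖χ‖ = 1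
  refinement : D χ + D (T χ) = ((√2 : ℝ) : ℂ) • χ
  dense : (Submodule.span ℂ
    (Set.range fun p : ℕ × ℤ => (D ^ p.1) ((T ^ p.2) χ))).topologicalClosure = ⊤

/-! ### Waves, energies, and the fine and coarse forms -/

namespace DyadicSystem

variable {H : Type*} [NormedAddCommGroup H] [InnerProductSpace ℂ H] (S : DyadicSystem H)

theorem semiconjBy_D : SemiconjBy S.D (S.T ^ 2) S.T := by
  ext f
  simp [pow_two, S.T_D]

theorem semiconjBy_D_pow (n : ℕ) : SemiconjBy (S.D ^ n) (S.T ^ 2 ^ n) S.T := by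
  induction n with
  | zero => simp [SemiconjBy]
  | succ n ih =>
    rw [pow_succ, pow_succ', pow_mul]
    exact ih.mul_left (S.semiconjBy_D.pow_right _)

/-- The vector `D^k T^j φ`. -/
noncomputable def wave (φ : H) (k j : ℤ) : H := (S.D ^ k) ((S.T ^ j) φ)

theorem wave_zero (φ : H) (j : ℤ) : S.wave φ 0 j = (S.T ^ j) φ := by simp [wave]

theorem wave_add_one (φ : H) (k j : ℤ) : S.wave φ (k + 1) j = S.D (S.wave φ k j) := by
  simp [wave, add_comm k 1, zpow_add]

theorem D_zpow_wave (φ : H) (k l j : ℤ) : (S.D ^ k) (S.wave φ l j) = S.wave φ (k + l) j := by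
  simp [wave, zpow_add]

theorem zpow_T_wave (φ : H) (i : ℤ) (n : ℕ) (j : ℤ) :
    (S.T ^ i) (S.wave φ n j) = S.wave φ n (2 ^ n * i + j) := by
  have h := congrArg (fun U : H ≃ₗᵢ[ℂ] H => U ((S.T ^ j) φ)) ((S.semiconjBy_D_pow n).zpow_right i).eq
  have e : (S.T ^ 2 ^ n) ^ i = S.T ^ ((2 : ℤ) ^ n * i) := by
    rw [zpow_mul]; norm_cast
  simp only [LinearIsometryEquiv.coe_mul, Function.comp_apply, e] at h
  simp only [wave, zpow_natCast, zpow_add, LinearIsometryEquiv.coe_mul, Function.comp_apply, h]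

theorem T_wave (φ : H) (n : ℕ) (j : ℤ) : S.T (S.wave φ n j) = S.wave φ n (j + 2 ^ n) := by
  simpa [add_comm] using S.zpow_T_wave φ 1 n j

theorem wave_two_mul_add (φ : H) (k j i : ℤ) :
    S.wave φ (k + 1) (2 * j + i) = S.wave (S.D ((S.T ^ i) φ)) k j := by
  have h := congrArg (fun U : H ≃ₗᵢ[ℂ] H => U ((S.T ^ i) φ)) (S.semiconjBy_D.zpow_right j).eq
  simp only [LinearIsometryEquiv.coe_mul, Function.comp_apply] at h
  have e : (S.T ^ 2) ^ j = S.T ^ (2 * j) := by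
    rw [zpow_mul]; norm_cast
  rw [e] at h
  simp only [wave, zpow_add, zpow_one, LinearIsometryEquiv.coe_mul, Function.comp_apply]
  rw [h]

theorem wave_smul (c : ℂ) (φ : H) (k j : ℤ) : S.wave (c • φ) k j = c • S.wave φ k j := by
  simp [wave]

theorem wave_add (φ φ' : H) (k j : ℤ) : S.wave (φ + φ') k j = S.wave φ k j + S.wave φ' k j := by
  simp [wave]

theorem norm_wave (φ : H) (k j : ℤ) : ‖S.wave φ k j‖ = ‖φ‖ := by simp [wave]

variable {S}

/-- A dyadic interval of length at most one lies in a single integer cell. The parity of `j` tells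
which half of its parent it is, and `D φ` or `D (T φ)` takes over the role of `φ` one scale up. -/
theorem exists_wave_eq {φ : H} (hφ : φ ∈ S.K) (n : ℕ) (j : ℤ) :
    ∃ i : ℤ, ∃ g ∈ S.K, S.wave φ n j = (S.T ^ i) g := by
  induction n generalizing j φ with
  | zero => exact ⟨j, φ, hφ, by simp [wave]⟩
  | succ n ih =>
    obtain ⟨i, rfl | rfl⟩ := j.even_or_odd'
    · have h := S.wave_two_mul_add φ n i 0
      simp only [add_zero, zpow_zero, LinearIsometryEquiv.coe_one, id] at h
      rw [Nat.cast_succ, h]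
      exact ih (S.D_mem _ hφ) i
    · have h := S.wave_two_mul_add φ n i 1
      rw [zpow_one] at h
      rw [Nat.cast_succ, h]
      exact ih (S.D_T_mem _ hφ) i

theorem inner_T_left {f g : H} (hf : f ∈ S.K) (hg : g ∈ S.K) : inner ℂ (S.T f) g = 0 := by
  simpa using S.inner_zpow_T 1 one_ne_zero f hf g hg

theorem inner_T_right {f g : H} (hf : f ∈ S.K) (hg : g ∈ S.K) : inner ℂ f (S.T g) = 0 := by
  rw [inner_eq_zero_symm]; exact inner_T_left hg hf

/-- Living in one cell, a fine wave cannot meet both cells `0` and `1`. This kills the cross terms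
in `energy_add_T`. -/
theorem inner_wave_left_or {φ f₀ f₁ : H} (hφ : φ ∈ S.K) (h₀ : f₀ ∈ S.K) (h₁ : f₁ ∈ S.K)
    (n : ℕ) (j : ℤ) :
    inner ℂ (S.wave φ n j) f₀ = 0 ∨ inner ℂ (S.wave φ n j) (S.T f₁) = 0 := by
  obtain ⟨i, g, hg, h⟩ := exists_wave_eq hφ n j
  rw [h]
  rcases eq_or_ne i 0 with rfl | hi
  · right
    simpa using inner_T_right hg h₁
  · exact .inl (S.inner_zpow_T i hi g hg f₀ h₀)

variable (S) in
/-- The energy of `f` at scale `k`: `∑_j |⟨D^k T^j φ, f⟩|²`. -/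
noncomputable def energy (φ : H) (k : ℤ) (f : H) : ℝ≥0∞ :=
  ∑' j : ℤ, ‖inner ℂ (S.wave φ k j) f‖ₑ ^ 2

theorem energy_T (φ : H) (n : ℕ) (f : H) : S.energy φ n (S.T f) = S.energy φ n f := by
  unfold energy
  -- A unit translation permutes the waves of scale `n` by `j ↦ j + 2 ^ n`, which needs `n ≥ 0`.
  rw [← (Equiv.addRight ((2 : ℤ) ^ n)).tsum_eq]
  refine tsum_congr fun j => ?_
  rw [Equiv.coe_addRight, ← T_wave, LinearIsometryEquiv.inner_map_map]

theorem energy_add_one_D (φ : H) (k : ℤ) (f : H) :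
    S.energy φ (k + 1) (S.D f) = S.energy φ k f := by
  unfold energy
  refine tsum_congr fun j => ?_
  rw [wave_add_one, LinearIsometryEquiv.inner_map_map]

theorem energy_smul (φ : H) (k : ℤ) (c : ℂ) (f : H) :
    S.energy φ k (c • f) = ‖c‖ₑ ^ 2 * S.energy φ k f := by
  unfold energy
  rw [← ENNReal.tsum_mul_left]
  refine tsum_congr fun j => ?_
  rw [inner_smul_right, enorm_mul, mul_pow]

theorem energy_add_T {φ f₀ f₁ : H} (hφ : φ ∈ S.K) (h₀ : f₀ ∈ S.K) (h₁ : f₁ ∈ S.K) (n : ℕ) :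
    S.energy φ n (f₀ + S.T f₁) = S.energy φ n f₀ + S.energy φ n f₁ := by
  rw [← energy_T φ n f₁]
  unfold energy
  rw [← ENNReal.tsum_add]
  refine tsum_congr fun j => ?_
  rw [inner_add_right]
  rcases inner_wave_left_or hφ h₀ h₁ n j with h | h <;> simp [h]

theorem energy_zero {φ f : H} (hφ : φ ∈ S.K) (hf : f ∈ S.K) :
    S.energy φ 0 f = ‖inner ℂ φ f‖ₑ ^ 2 := by
  unfold energy
  rw [tsum_eq_single 0]
  · simp [wave]
  · intro j hj
    rw [wave_zero, S.inner_zpow_T j hj φ hφ f hf]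
    simp

theorem D_pow_mem {f : H} (hf : f ∈ S.K) (n : ℕ) : (S.D ^ n) f ∈ S.K := by
  induction n with
  | zero => simpa
  | succ n ih =>
    rw [pow_succ']
    exact S.D_mem _ ih

theorem energy_neg {φ : H} (n : ℕ) (f : H) :
    S.energy φ (-n : ℤ) f = S.energy φ 0 ((S.D ^ n) f) := by
  induction n generalizing f with
  | zero => simp
  | succ n ih =>
    have h := energy_add_one_D (S := S) φ (-(n + 1 : ℕ) : ℤ) f
    rw [← h, pow_succ, LinearIsometryEquiv.coe_mul, Function.comp_apply, ← ih]
    congr 1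
    push_cast
    ring

variable (S) in
/-- The total energy of `f` at the scales `k < 0`. -/
noncomputable def coarse (φ : H) (f : H) : ℝ≥0∞ := ∑' n : ℕ, S.energy φ (-(n + 1 : ℕ)) f

variable (S) in
/-- The total energy of `f` at the scales `k ≥ 0`. -/
noncomputable def fine (φ : H) (f : H) : ℝ≥0∞ := ∑' n : ℕ, S.energy φ n f

theorem tsum_energy (φ f : H) : ∑' k : ℤ, S.energy φ k f = S.fine φ f + S.coarse φ f :=
  ENNReal.tsum_int_eq _

theorem fine_T (φ f : H) : S.fine φ (S.T f) = S.fine φ f := by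
  simp only [fine, energy_T]

theorem fine_add_T {φ f₀ f₁ : H} (hφ : φ ∈ S.K) (h₀ : f₀ ∈ S.K) (h₁ : f₁ ∈ S.K) :
    S.fine φ (f₀ + S.T f₁) = S.fine φ f₀ + S.fine φ f₁ := by
  simp only [fine, energy_add_T hφ h₀ h₁, ENNReal.tsum_add]

theorem coarse_eq_energy_add_coarse_D (φ f : H) :
    S.coarse φ f = S.energy φ 0 (S.D f) + S.coarse φ (S.D f) := by
  have h (n : ℕ) : S.energy φ (-(n + 1 : ℕ)) f = S.energy φ (-n : ℤ) (S.D f) := by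
    rw [← energy_add_one_D]
    congr 1
    push_cast
    ring
  simp only [coarse, h]
  rw [tsum_eq_zero_add' ENNReal.summable]
  simp

/-- Rescaling moves the scale `-(n + 1)` to the scale `0`, where only `j = 0` meets a vector of `K`.
-/
theorem coarse_eq_tsum {φ f : H} (hφ : φ ∈ S.K) (hf : S.D f ∈ S.K) :
    S.coarse φ f = ∑' n : ℕ, ‖inner ℂ φ ((S.D ^ n) (S.D f))‖ₑ ^ 2 := by
  refine tsum_congr fun n => ?_
  rw [energy_neg, pow_succ, LinearIsometryEquiv.coe_mul, Function.comp_apply,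
    energy_zero hφ (D_pow_mem hf n)]

variable (S) in
/-- The wavelet system generated by `φ` is a tight frame with bound `b`. -/
def IsTight (φ : H) (b : ℝ≥0∞) : Prop := ∀ f : H, ∑' k : ℤ, S.energy φ k f = b * ‖f‖ₑ ^ 2

theorem add_mem_of_mem {f₀ f₁ : H} (h₀ : f₀ ∈ S.K) (h₁ : f₁ ∈ S.K) :
    S.D f₀ + S.D (S.T f₁) ∈ S.K :=
  S.K.add_mem (S.D_mem _ h₀) (S.D_T_mem _ h₁)

theorem enorm_sq_add_D_T {f₀ f₁ : H} (h₀ : f₀ ∈ S.K) (h₁ : f₁ ∈ S.K) :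
    ‖S.D f₀ + S.D (S.T f₁)‖ₑ ^ 2 = ‖f₀‖ₑ ^ 2 + ‖f₁‖ₑ ^ 2 := by
  rw [enorm_sq_add_of_inner_eq_zero]
  · simp only [enorm_sq_eq_ofReal_norm_sq, LinearIsometryEquiv.norm_map]
  · rw [LinearIsometryEquiv.inner_map_map, inner_T_right h₀ h₁]

theorem fine_add_coarse {ψ : H} {b : ℝ≥0∞} (ht : S.IsTight ψ b) (f : H) :
    S.fine ψ f + S.coarse ψ f = b * ‖f‖ₑ ^ 2 := by
  rw [← tsum_energy, ht f]

/-! ### Consequences of tightness for the coarse form -/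

section Tight

variable {ψ : H} {b : ℝ≥0∞} (hψ : ψ ∈ S.K) (hb : b ≠ ∞) (ht : S.IsTight ψ b)
include hb ht

theorem fine_add_coarse_ne_top (f : H) : S.fine ψ f + S.coarse ψ f ≠ ∞ := by
  rw [fine_add_coarse ht]
  exact ENNReal.mul_ne_top hb (enorm_sq_ne_top f)

theorem fine_ne_top (f : H) : S.fine ψ f ≠ ∞ :=
  ne_top_of_le_ne_top (fine_add_coarse_ne_top hb ht f) le_self_add

/-- Not visible from the coarse sum itself: it follows by cancelling the finite, invariant `fine`
part from the invariant total `b‖f‖²`. The additivity in `coarse_add_T` is obtained in the same way.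
-/
theorem coarse_T (f : H) : S.coarse ψ (S.T f) = S.coarse ψ f := by
  refine (ENNReal.add_right_inj (fine_ne_top hb ht f)).1 ?_
  rw [fine_add_coarse ht, ← fine_T, fine_add_coarse ht]
  simp only [enorm_sq_eq_ofReal_norm_sq, LinearIsometryEquiv.norm_map]

include hψ

theorem coarse_add_T {f₀ f₁ : H} (h₀ : f₀ ∈ S.K) (h₁ : f₁ ∈ S.K) :
    S.coarse ψ (f₀ + S.T f₁) = S.coarse ψ f₀ + S.coarse ψ f₁ := by
  refine (ENNReal.add_right_inj (fine_ne_top hb ht (f₀ + S.T f₁))).1 ?_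
  rw [fine_add_coarse ht, fine_add_T hψ h₀ h₁, add_add_add_comm, fine_add_coarse ht,
    fine_add_coarse ht, enorm_sq_add_of_inner_eq_zero (inner_T_right h₀ h₁), mul_add]
  simp only [enorm_sq_eq_ofReal_norm_sq, LinearIsometryEquiv.norm_map]

/-- Splitting the unit interval into its halves. -/
theorem coarse_add_coarse {f₀ f₁ : H} (h₀ : f₀ ∈ S.K) (h₁ : f₁ ∈ S.K) :
    S.coarse ψ f₀ + S.coarse ψ f₁ = S.coarse ψ (S.D f₀ + S.D (S.T f₁)) +
      ‖inner ℂ ψ (S.D f₀ + S.D (S.T f₁))‖ₑ ^ 2 := by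
  rw [← coarse_add_T hψ hb ht h₀ h₁, coarse_eq_energy_add_coarse_D, map_add,
    energy_zero hψ (add_mem_of_mem h₀ h₁), add_comm]

theorem coarse_D {f : H} (hf : f ∈ S.K) :
    S.coarse ψ f = S.coarse ψ (S.D f) + ‖inner ℂ ψ (S.D f)‖ₑ ^ 2 := by
  have h := coarse_add_coarse hψ hb ht hf S.K.zero_mem
  have h0 : S.coarse ψ 0 = 0 := by simp [coarse, energy]
  simpa [h0] using h

theorem coarse_D_T {f : H} (hf : f ∈ S.K) :
    S.coarse ψ f = S.coarse ψ (S.D (S.T f)) + ‖inner ℂ ψ (S.D (S.T f))‖ₑ ^ 2 := by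
  have h := coarse_add_coarse hψ hb ht S.K.zero_mem hf
  have h0 : S.coarse ψ 0 = 0 := by simp [coarse, energy]
  simpa [h0] using h

end Tight

/-! ### Halving vectors of `K`; the coarse form has rank one -/

theorem exists_halves : ∃ L R : H → H, ∀ f ∈ S.K, L f ∈ S.K ∧ R f ∈ S.K ∧
    f = S.D (L f) + S.D (S.T (R f)) := by
  have h (f : H) : ∃ p : H × H, f ∈ S.K → p.1 ∈ S.K ∧ p.2 ∈ S.K ∧
      f = S.D p.1 + S.D (S.T p.2) := by
    by_cases hf : f ∈ S.K
    · obtain ⟨f₀, h₀, f₁, h₁, e⟩ := S.exists_eq_add f hf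
      exact ⟨(f₀, f₁), fun _ => ⟨h₀, h₁, e⟩⟩
    · exact ⟨0, fun h => absurd h hf⟩
  choose p hp using h
  exact ⟨fun f => (p f).1, fun f => (p f).2, hp⟩

theorem inner_add_D {f₀ f₁ g : H} (h₁ : f₁ ∈ S.K) (hg : g ∈ S.K) :
    inner ℂ (S.D f₀ + S.D (S.T f₁)) (S.D g) = inner ℂ f₀ g := by
  rw [inner_add_left, LinearIsometryEquiv.inner_map_map, LinearIsometryEquiv.inner_map_map,
    inner_T_left h₁ hg, add_zero]

theorem inner_add_D_T {f₀ f₁ g : H} (h₀ : f₀ ∈ S.K) (hg : g ∈ S.K) :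
    inner ℂ (S.D f₀ + S.D (S.T f₁)) (S.D (S.T g)) = inner ℂ f₁ g := by
  rw [inner_add_left, LinearIsometryEquiv.inner_map_map, LinearIsometryEquiv.inner_map_map,
    LinearIsometryEquiv.inner_map_map, inner_T_right h₀ hg, zero_add]

/-- Pythagoras applied to repeated halving of the left piece: the right halves split off are
mutually orthogonal pieces of `v 0`. -/
theorem enorm_sq_tsum_le {v u : ℕ → H} (hv : ∀ n, v n ∈ S.K) (hu : ∀ n, u n ∈ S.K)
    (h : ∀ n, v n = S.D (v (n + 1)) + S.D (S.T (u n))) :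
    ∑' n, ‖u n‖ₑ ^ 2 ≤ ‖v 0‖ₑ ^ 2 := by
  refine ENNReal.tsum_le_of_sum_range_le fun N => ?_
  suffices hs : ∑ n ∈ Finset.range N, ‖u n‖ₑ ^ 2 + ‖v N‖ₑ ^ 2 = ‖v 0‖ₑ ^ 2 from
    hs ▸ le_self_add
  induction N with
  | zero => simp
  | succ N ih =>
    have e := enorm_sq_add_D_T (hv (N + 1)) (hu N)
    rw [← h N] at e
    rw [← ih, e, Finset.sum_range_succ]
    ring

/-- For a tight frame, the coarse form is of rank at most one, and vanishes at `ψ`. -/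
theorem exists_coarse_eq_zero {ψ : H} {b : ℝ≥0∞} (hψ : ψ ∈ S.K) (hψ0 : ψ ≠ 0) (hb : b ≠ ∞)
    (ht : S.IsTight ψ b) :
    ∃ u ∈ S.K, u ≠ 0 ∧ (∀ g ∈ S.K, S.coarse ψ g = 0 ↔ inner ℂ u g = 0) ∧
      S.coarse ψ ψ = 0 := by
  obtain ⟨L, R, hLR⟩ := exists_halves (S := S)
  -- `v n` is `ψ` on the leftmost dyadic interval of length `2⁻ⁿ`, rescaled to unit length; `u n`
  -- below is its right half.
  let v : ℕ → H := fun n => L^[n] ψ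
  have hv (n : ℕ) : v n ∈ S.K := by
    induction n with
    | zero => exact hψ
    | succ n ih =>
      simp only [v, Function.iterate_succ', Function.comp_apply] at ih ⊢
      exact (hLR _ ih).1
  let u : ℕ → H := fun n => R (v n)
  have hu (n : ℕ) : u n ∈ S.K := (hLR _ (hv n)).2.1
  have hvu (n : ℕ) : v n = S.D (v (n + 1)) + S.D (S.T (u n)) := by
    have := (hLR _ (hv n)).2.2
    simpa only [v, Function.iterate_succ', Function.comp_apply] using this
  have hsum : ∑' n, ‖u n‖ₑ ^ 2 ≤ ‖ψ‖ₑ ^ 2 := enorm_sq_tsum_le hv hu hvu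
  have hvD {g : H} (hg : g ∈ S.K) (n : ℕ) : inner ℂ ψ ((S.D ^ n) g) = inner ℂ (v n) g := by
    induction n generalizing g with
    | zero => rfl
    | succ n ih =>
      rw [pow_succ, LinearIsometryEquiv.coe_mul, Function.comp_apply, ih (S.D_mem _ hg), hvu n,
        inner_add_D (hu n) hg]
  have hq {g : H} (hg : g ∈ S.K) : S.coarse ψ g = ∑' n, ‖inner ℂ (u n) g‖ₑ ^ 2 := by
    -- Translating `g` first is the point: the vectors `D ^ n (D (T g))` then occupy the disjoint
    -- intervals `[2⁻ⁿ⁻¹, 2⁻ⁿ]`, so the representing vectors are the square-summable `u n`.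
    rw [← coarse_T hb ht, coarse_eq_tsum hψ (S.D_T_mem _ hg)]
    refine tsum_congr fun n => ?_
    rw [hvD (S.D_T_mem _ hg), hvu n, inner_add_D_T (hv _) hg]
  -- `∑ coarse (u m)` is the squared Hilbert–Schmidt norm of the coarse form. Its double is computed
  -- by splitting each `u m` off as a left and as a right half, exchanging the sums over `m` and
  -- `n`, and recombining the halves of `u n` and of `ψ`.
  have hdouble : (∑' m, S.coarse ψ (u m)) + ∑' m, S.coarse ψ (u m) =
      (∑' m, S.coarse ψ (u m)) + (S.coarse ψ ψ + (S.coarse ψ ψ + (‖ψ‖ₑ ^ 2) ^ 2)) := by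
    have h1 {x : H} (hx : x ∈ S.K) : ∑' m, (‖inner ℂ x (S.D (u m))‖ₑ ^ 2 +
        ‖inner ℂ x (S.D (S.T (u m)))‖ₑ ^ 2) = S.coarse ψ x + ‖inner ℂ ψ x‖ₑ ^ 2 := by
      obtain ⟨hL, hR, e⟩ := hLR x hx
      have h2 := coarse_add_coarse hψ hb ht hL hR
      rw [← e] at h2
      rw [← h2, hq hL, hq hR, ← ENNReal.tsum_add]
      refine tsum_congr fun m => ?_
      rw [e, inner_add_D hR (hu m), inner_add_D_T hL (hu m), enorm_inner_comm,
        enorm_inner_comm (R x)]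
      simp only [← e]
    calc (∑' m, S.coarse ψ (u m)) + ∑' m, S.coarse ψ (u m)
        = ∑' m, ((S.coarse ψ (S.D (u m)) + ‖inner ℂ ψ (S.D (u m))‖ₑ ^ 2) +
            (S.coarse ψ (S.D (S.T (u m))) + ‖inner ℂ ψ (S.D (S.T (u m)))‖ₑ ^ 2)) := by
          rw [← ENNReal.tsum_add]
          refine tsum_congr fun m => ?_
          rw [← coarse_D hψ hb ht (hu m), ← coarse_D_T hψ hb ht (hu m)]
      _ = (∑' m, ∑' n, (‖inner ℂ (u n) (S.D (u m))‖ₑ ^ 2 +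
            ‖inner ℂ (u n) (S.D (S.T (u m)))‖ₑ ^ 2)) +
          ∑' m, (‖inner ℂ ψ (S.D (u m))‖ₑ ^ 2 + ‖inner ℂ ψ (S.D (S.T (u m)))‖ₑ ^ 2) := by
          rw [← ENNReal.tsum_add]
          refine tsum_congr fun m => ?_
          rw [add_add_add_comm, hq (S.D_mem _ (hu m)), hq (S.D_T_mem _ (hu m)),
            ENNReal.tsum_add]
      _ = _ := by
          rw [ENNReal.tsum_comm, h1 hψ, enorm_inner_self]
          simp only [h1 (hu _), ENNReal.tsum_add]
          simp only [enorm_inner_comm ψ (u _)]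
          rw [← hq hψ, add_assoc]
  have hle (i : ℕ × ℕ) : ‖inner ℂ (u i.2) (u i.1)‖ₑ ^ 2 ≤ ‖u i.2‖ₑ ^ 2 * ‖u i.1‖ₑ ^ 2 := by
    rw [← mul_pow]
    gcongr
    exact enorm_inner_le _ _
  have hτ : ∑' m, S.coarse ψ (u m) = ∑' i : ℕ × ℕ, ‖inner ℂ (u i.2) (u i.1)‖ₑ ^ 2 := by
    rw [ENNReal.tsum_prod (f := fun m n => ‖inner ℂ (u n) (u m)‖ₑ ^ 2)]
    exact tsum_congr fun m => hq (hu m)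
  have hprod : ∑' i : ℕ × ℕ, ‖u i.2‖ₑ ^ 2 * ‖u i.1‖ₑ ^ 2 = (∑' n, ‖u n‖ₑ ^ 2) ^ 2 := by
    rw [ENNReal.tsum_prod (f := fun m n => ‖u n‖ₑ ^ 2 * ‖u m‖ₑ ^ 2)]
    simp only [ENNReal.tsum_mul_right, ENNReal.tsum_mul_left]
    rw [sq]
  have hle2 : ∑' i : ℕ × ℕ, ‖u i.2‖ₑ ^ 2 * ‖u i.1‖ₑ ^ 2 ≤ (‖ψ‖ₑ ^ 2) ^ 2 := by
    rw [hprod]; gcongr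
  have hτle : ∑' m, S.coarse ψ (u m) ≤ (‖ψ‖ₑ ^ 2) ^ 2 :=
    hτ ▸ (ENNReal.tsum_le_tsum hle).trans hle2
  have hp : (‖ψ‖ₑ ^ 2) ^ 2 ≠ ∞ := ENNReal.pow_ne_top (enorm_sq_ne_top ψ)
  have hτtop := ne_top_of_le_ne_top hp hτle
  -- The norm equals `2 coarse ψ + ‖ψ‖⁴` and is at most `‖ψ‖⁴`, so all the preceding inequalities
  -- are equalities.
  have hτeq := (ENNReal.add_right_inj hτtop).1 hdouble
  have hp0 : (‖ψ‖ₑ ^ 2) ^ 2 ≠ 0 := by simpa using hψ0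
  have hψq : S.coarse ψ ψ = 0 := by
    have h1 : S.coarse ψ ψ + (‖ψ‖ₑ ^ 2) ^ 2 ≤ 0 + (‖ψ‖ₑ ^ 2) ^ 2 := by
      rw [zero_add]
      exact (le_add_self.trans hτeq.ge).trans hτle
    simpa using (ENNReal.add_le_add_iff_right hp).1 h1
  rw [hψq, zero_add, zero_add] at hτeq
  have heq : ∀ i : ℕ × ℕ, ‖inner ℂ (u i.2) (u i.1)‖ₑ ^ 2 = ‖u i.2‖ₑ ^ 2 * ‖u i.1‖ₑ ^ 2 :=
    ENNReal.eq_of_le_of_tsum_le hle (hτ ▸ hτtop) (by rw [← hτ, hτeq]; exact hle2)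
  have hex : ∃ m, u m ≠ 0 := by
    by_contra! h
    rw [hτeq.symm] at hp0
    exact hp0 (by simp [h, coarse, energy])
  obtain ⟨m, hm⟩ := hex
  refine ⟨u m, hu m, hm, fun g hg => ⟨fun h => ?_, fun h => ?_⟩, hψq⟩
  · rw [hq hg, ENNReal.tsum_eq_zero] at h
    simpa using h m
  · rw [hq hg, ENNReal.tsum_eq_zero]
    intro n
    have e := heq (n, m)
    simp only [enorm_sq_eq_ofReal_norm_sq] at e
    rw [← ENNReal.ofReal_mul (by positivity),
      ENNReal.ofReal_eq_ofReal_iff (by positivity) (by positivity), ← mul_pow,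
      pow_left_inj₀ (by positivity) (by positivity) two_ne_zero] at e
    -- Equality in Cauchy–Schwarz makes every `u n` a multiple of `u m`.
    rcases eq_or_ne (u n) 0 with h0 | h0
    · simp [h0]
    · obtain ⟨r, -, hr⟩ := (norm_inner_eq_norm_iff hm h0).1 e
      rw [hr, inner_smul_left, h]
      simp

/-- The component of `x` orthogonal to `u` stays in `K`, so it is orthogonal to `x` and to `u`,
hence to itself. -/
theorem eq_smul_of_forall_inner_eq_zero {u x : H} {K : Submodule ℂ H} (hu : u ∈ K) (hx : x ∈ K)
    (h0 : u ≠ 0) (h : ∀ g ∈ K, inner ℂ u g = 0 → inner ℂ x g = 0) : ∃ c : ℂ, x = c • u := by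
  have hs : inner ℂ u u ≠ (0 : ℂ) := inner_self_ne_zero.2 h0
  refine ⟨inner ℂ u x / inner ℂ u u, ?_⟩
  set c : ℂ := inner ℂ u x / inner ℂ u u
  have h1 : inner ℂ u (x - c • u) = 0 := by
    rw [inner_sub_right, inner_smul_right, div_mul_cancel₀ _ hs, sub_self]
  have h2 := h _ (K.sub_mem hx (K.smul_mem c hu)) h1
  rw [← sub_eq_zero, ← inner_self_eq_zero (𝕜 := ℂ), inner_sub_left, inner_smul_left, h1, h2]
  simp

/-- For a tight frame, `ψ` and some nonzero self-similar vector `u` orthogonal to `ψ` have all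
halves proportional to `u`. -/
theorem exists_selfSimilar {ψ : H} {b : ℝ≥0∞} (hψ : ψ ∈ S.K) (hψ0 : ψ ≠ 0) (hb : b ≠ ∞)
    (ht : S.IsTight ψ b) :
    ∃ u ∈ S.K, u ≠ 0 ∧ inner ℂ u ψ = 0 ∧
      (∃ a₀ a₁ : ℂ, u = S.D (a₀ • u) + S.D (S.T (a₁ • u))) ∧
      ∃ c₀ c₁ : ℂ, ψ = S.D (c₀ • u) + S.D (S.T (c₁ • u)) := by
  obtain ⟨u, hu, hu0, hq, hψq⟩ := exists_coarse_eq_zero hψ hψ0 hb ht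
  have key {x : H} (hx : x ∈ S.K) (hD : ∀ g ∈ S.K, inner ℂ u g = 0 → inner ℂ x (S.D g) = 0)
      (hDT : ∀ g ∈ S.K, inner ℂ u g = 0 → inner ℂ x (S.D (S.T g)) = 0) :
      ∃ a₀ a₁ : ℂ, x = S.D (a₀ • u) + S.D (S.T (a₁ • u)) := by
    obtain ⟨x₀, h₀, x₁, h₁, e⟩ := S.exists_eq_add x hx
    obtain ⟨a₀, rfl⟩ := eq_smul_of_forall_inner_eq_zero hu h₀ hu0 fun g hg h => by
      rw [← hD g hg h, e, inner_add_D h₁ hg]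
    obtain ⟨a₁, rfl⟩ := eq_smul_of_forall_inner_eq_zero hu h₁ hu0 fun g hg h => by
      rw [← hDT g hg h, e, inner_add_D_T h₀ hg]
    exact ⟨a₀, a₁, e⟩
  -- For `g ⊥ u` the nonnegative terms of `0 = coarse g = coarse (D g) + |⟨ψ, D g⟩|²` both vanish,
  -- so `D g` is orthogonal to `u` and to `ψ`.
  have hD (g : H) (hg : g ∈ S.K) (h : inner ℂ u g = 0) :
      S.coarse ψ (S.D g) = 0 ∧ inner ℂ ψ (S.D g) = 0 := by
    have := coarse_D hψ hb ht hg
    rw [(hq g hg).2 h] at this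
    simpa using this.symm
  have hDT (g : H) (hg : g ∈ S.K) (h : inner ℂ u g = 0) :
      S.coarse ψ (S.D (S.T g)) = 0 ∧ inner ℂ ψ (S.D (S.T g)) = 0 := by
    have := coarse_D_T hψ hb ht hg
    rw [(hq g hg).2 h] at this
    simpa using this.symm
  exact ⟨u, hu, hu0, (hq ψ hψ).1 hψq,
    key hu (fun g hg h => (hq _ (S.D_mem _ hg)).1 (hD g hg h).1)
      fun g hg h => (hq _ (S.D_T_mem _ hg)).1 (hDT g hg h).1,
    key hψ (fun g hg h => (hD g hg h).2) fun g hg h => (hDT g hg h).2⟩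

end DyadicSystem

/-! ### Density of spans and Parseval's identity -/

section Basis

variable {ι E : Type*} [NormedAddCommGroup E] [InnerProductSpace ℂ E] [CompleteSpace E]

theorem topologicalClosure_span_range_eq_top_iff {v : ι → E} :
    (Submodule.span ℂ (Set.range v)).topologicalClosure = ⊤ ↔
      ∀ f, (∀ i, inner ℂ (v i) f = 0) → f = 0 := by
  rw [Submodule.topologicalClosure_eq_top_iff, Submodule.eq_bot_iff]
  simp only [Submodule.mem_orthogonal]
  refine ⟨fun h f hf => h f fun x hx => ?_, fun h f hf => h f fun i =>
    hf _ (Submodule.subset_span ⟨i, rfl⟩)⟩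
  induction hx using Submodule.span_induction with
  | mem x hx => obtain ⟨i, rfl⟩ := hx; exact hf i
  | zero => simp
  | add x y _ _ hx hy => rw [inner_add_left, hx, hy, add_zero]
  | smul a x _ hx => rw [inner_smul_left, hx, mul_zero]

theorem Orthonormal.tsum_enorm_inner_sq {v : ι → E} (hv : Orthonormal ℂ v)
    (hd : (Submodule.span ℂ (Set.range v)).topologicalClosure = ⊤) (f : E) :
    ∑' i, ‖inner ℂ (v i) f‖ₑ ^ 2 = ‖f‖ₑ ^ 2 := by
  let b := HilbertBasis.mk hv hd.ge
  have hbv : ⇑b = v := HilbertBasis.coe_mk hv hd.ge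
  have h := b.hasSum_inner_mul_inner f f
  have h2 : HasSum (fun i => ‖inner ℂ (v i) f‖ ^ 2) (‖f‖ ^ 2) := by
    rw [← Complex.hasSum_ofReal]
    have e1 : (((‖f‖ ^ 2 : ℝ)) : ℂ) = inner ℂ f f := by
      rw [inner_self_eq_norm_sq_to_K]
      simp
    have e2 (i : ι) : ((‖inner ℂ (v i) f‖ ^ 2 : ℝ) : ℂ) = inner ℂ f (b i) * inner ℂ (b i) f := by
      rw [hbv, ← inner_conj_symm f, ← Complex.normSq_eq_conj_mul_self, Complex.normSq_eq_norm_sq]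
    simpa only [e1, e2] using h
  simp only [enorm_sq_eq_ofReal_norm_sq]
  rw [← h2.tsum_eq, ENNReal.ofReal_tsum_of_nonneg (fun _ => by positivity) h2.summable]

end Basis

/-! ### The Haar system is orthonormal -/

namespace DyadicSystem

variable {H : Type*} [NormedAddCommGroup H] [InnerProductSpace ℂ H] {S : DyadicSystem H}

/-- The scalar `1 / √2`. -/
noncomputable def halfSqrt : ℂ := (((√2)⁻¹ : ℝ) : ℂ)

theorem halfSqrt_mul_sqrt : halfSqrt * ((√2 : ℝ) : ℂ) = 1 := by
  rw [halfSqrt, ← Complex.ofReal_mul, inv_mul_cancel₀ (by positivity), Complex.ofReal_one]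

theorem halfSqrt_ne_zero : halfSqrt ≠ 0 := left_ne_zero_of_mul_eq_one halfSqrt_mul_sqrt

theorem norm_halfSqrt : ‖halfSqrt‖ = (√2)⁻¹ := by
  rw [halfSqrt, Complex.norm_real, Real.norm_of_nonneg (by positivity)]

theorem norm_halfSqrt_sq : ‖halfSqrt‖ ^ 2 = 1 / 2 := by
  rw [norm_halfSqrt, inv_pow, Real.sq_sqrt (by norm_num), one_div]

theorem conj_halfSqrt : (starRingEnd ℂ) halfSqrt = halfSqrt := Complex.conj_ofReal _

theorem χ_eq : S.χ = halfSqrt • (S.D S.χ + S.D (S.T S.χ)) := by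
  rw [S.refinement, smul_smul, halfSqrt_mul_sqrt, one_smul]

variable (S) in
/-- The Haar vector. -/
noncomputable def haar : H := halfSqrt • (S.D S.χ - S.D (S.T S.χ))

theorem haar_mem : S.haar ∈ S.K :=
  S.K.smul_mem _ (S.K.sub_mem (S.D_mem _ S.χ_mem) (S.D_T_mem _ S.χ_mem))

theorem haar_eq_add : S.haar = S.D (halfSqrt • S.χ) + S.D (S.T (-halfSqrt • S.χ)) := by
  simp only [haar, map_smul, neg_smul, map_neg, smul_sub]
  abel

theorem χ_eq_add : S.χ = S.D (halfSqrt • S.χ) + S.D (S.T (halfSqrt • S.χ)) := by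
  conv_lhs => rw [χ_eq]
  simp only [map_smul, smul_add]

theorem χ_smul_mem (c : ℂ) : c • S.χ ∈ S.K := S.K.smul_mem c S.χ_mem

theorem inner_χ_χ : inner ℂ S.χ S.χ = (1 : ℂ) := by
  rw [inner_self_eq_norm_sq_to_K, S.norm_χ]; simp

theorem inner_χ_D {g : H} (hg : g ∈ S.K) : inner ℂ S.χ (S.D g) = halfSqrt * inner ℂ S.χ g := by
  rw [χ_eq_add (S := S), inner_add_D (χ_smul_mem _) hg, inner_smul_left, conj_halfSqrt,
    ← χ_eq_add]

theorem inner_χ_D_T {g : H} (hg : g ∈ S.K) :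
    inner ℂ S.χ (S.D (S.T g)) = halfSqrt * inner ℂ S.χ g := by
  rw [χ_eq_add (S := S), inner_add_D_T (χ_smul_mem _) hg, inner_smul_left, conj_halfSqrt,
    ← χ_eq_add]

theorem inner_haar_D {g : H} (hg : g ∈ S.K) :
    inner ℂ S.haar (S.D g) = halfSqrt * inner ℂ S.χ g := by
  rw [haar_eq_add, inner_add_D (χ_smul_mem _) hg, inner_smul_left, conj_halfSqrt]

theorem inner_χ_haar : inner ℂ S.χ S.haar = (0 : ℂ) := by
  rw [haar, inner_smul_right, inner_sub_right, inner_χ_D S.χ_mem, inner_χ_D_T S.χ_mem, sub_self,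
    mul_zero]

theorem norm_haar : ‖S.haar‖ = 1 := by
  have h := enorm_sq_add_D_T (S := S) (χ_smul_mem halfSqrt) (χ_smul_mem (-halfSqrt))
  rw [← haar_eq_add] at h
  simp only [enorm_sq_eq_ofReal_norm_sq, norm_smul, norm_neg, S.norm_χ, mul_one,
    norm_halfSqrt_sq] at h
  rw [← ENNReal.ofReal_add (by norm_num) (by norm_num),
    ENNReal.ofReal_eq_ofReal_iff (by positivity) (by norm_num)] at h
  have h' : ‖S.haar‖ ^ 2 = 1 := by rw [h]; norm_num
  exact (pow_eq_one_iff_of_nonneg (norm_nonneg _) two_ne_zero).1 h'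

theorem inner_zpow_T_wave (φ φ' : H) (i : ℤ) (n : ℕ) (j : ℤ) :
    inner ℂ ((S.T ^ i) φ) (S.wave φ' n j) = inner ℂ φ (S.wave φ' n (j - 2 ^ n * i)) := by
  rw [← LinearIsometryEquiv.inner_map_map (S.T ^ i) φ, zpow_T_wave]
  congr 2
  ring

/-- The refinement equation writes `χ` through `D χ` and `D (T χ)`; cancelling the unitary `D`
lowers the scale of the wave by one. -/
theorem inner_χ_wave_haar (n : ℕ) (j : ℤ) : inner ℂ S.χ (S.wave S.haar n j) = (0 : ℂ) := by
  induction n generalizing j with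
  | zero =>
    rw [Nat.cast_zero, wave_zero]
    rcases eq_or_ne j 0 with rfl | hj
    · simpa using inner_χ_haar
    · rw [inner_eq_zero_symm]
      exact S.inner_zpow_T j hj _ haar_mem _ S.χ_mem
  | succ n ih =>
    have h := inner_zpow_T_wave (S := S) S.χ S.haar 1 n j
    rw [zpow_one, ih] at h
    rw [χ_eq, Nat.cast_succ, wave_add_one, inner_smul_left, inner_add_left,
      LinearIsometryEquiv.inner_map_map, LinearIsometryEquiv.inner_map_map, ih, h]
    simp

/-- At scale `0` the supports are in different cells. At a finer scale, cancelling one `D` leaves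
only pairings of `χ` and `T χ` with Haar waves. -/
theorem inner_haar_wave_haar (n : ℕ) (j : ℤ) (h : n ≠ 0 ∨ j ≠ 0) :
    inner ℂ S.haar (S.wave S.haar n j) = (0 : ℂ) := by
  cases n with
  | zero =>
    rw [Nat.cast_zero, wave_zero, inner_eq_zero_symm]
    exact S.inner_zpow_T j (by simpa using h) _ haar_mem _ haar_mem
  | succ n =>
    have h := inner_zpow_T_wave (S := S) S.χ S.haar 1 n j
    rw [zpow_one, inner_χ_wave_haar] at h
    conv_lhs => rw [Nat.cast_succ, wave_add_one]; arg 2; rw [haar]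
    rw [inner_smul_left, inner_sub_left,
      LinearIsometryEquiv.inner_map_map, LinearIsometryEquiv.inner_map_map, inner_χ_wave_haar, h]
    simp

theorem inner_wave_haar_of_le {k k' j j' : ℤ} (hk : k ≤ k') (h : (k, j) ≠ (k', j')) :
    inner ℂ (S.wave S.haar k j) (S.wave S.haar k' j') = (0 : ℂ) := by
  obtain ⟨n, rfl⟩ := Int.le.dest hk
  rw [← D_zpow_wave, wave, LinearIsometryEquiv.inner_map_map, inner_zpow_T_wave]
  refine inner_haar_wave_haar n _ ?_
  by_contra! hc
  obtain ⟨rfl, hc⟩ := hc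
  exact h (by simpa [sub_eq_zero, eq_comm] using hc)

theorem orthonormal_haar : Orthonormal ℂ fun p : ℤ × ℤ => S.wave S.haar p.1 p.2 := by
  refine ⟨fun p => by rw [norm_wave, norm_haar], fun p p' hp => ?_⟩
  rcases le_total p.1 p'.1 with h | h
  · exact inner_wave_haar_of_le h hp
  · rw [inner_eq_zero_symm]
    exact inner_wave_haar_of_le h hp.symm

theorem wave_χ (k j : ℤ) : S.wave S.χ k j =
    halfSqrt • (S.wave S.χ (k + 1) (2 * j) + S.wave S.χ (k + 1) (2 * j + 1)) := by
  have h0 := S.wave_two_mul_add S.χ k j 0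
  have h1 := S.wave_two_mul_add S.χ k j 1
  simp only [add_zero, zpow_zero, zpow_one, LinearIsometryEquiv.coe_one, id] at h0 h1
  rw [h0, h1, ← wave_add, ← wave_smul, ← χ_eq]

theorem wave_haar (k j : ℤ) : S.wave S.haar k j =
    halfSqrt • (S.wave S.χ (k + 1) (2 * j) - S.wave S.χ (k + 1) (2 * j + 1)) := by
  have h0 := S.wave_two_mul_add S.χ k j 0
  have h1 := S.wave_two_mul_add S.χ k j 1
  simp only [add_zero, zpow_zero, zpow_one, LinearIsometryEquiv.coe_one, id] at h0 h1
  rw [h0, h1, haar, wave_smul, sub_eq_add_neg, sub_eq_add_neg, wave_add]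
  simp [wave]

/-- Orthogonality to a Haar wave makes the coefficients of `f` on the two children equal, each
`1/√2` times that of the parent. Since all coefficients are at most `‖f‖`, passing to ever coarser
ancestors forces them to vanish. -/
theorem inner_wave_χ_of_forall_inner_haar {f : H}
    (hf : ∀ k j : ℤ, inner ℂ (S.wave S.haar k j) f = 0) (k j : ℤ) :
    inner ℂ (S.wave S.χ k j) f = 0 := by
  have key (k j : ℤ) :
      inner ℂ (S.wave S.χ (k + 1) (2 * j)) f = halfSqrt * inner ℂ (S.wave S.χ k j) f ∧
      inner ℂ (S.wave S.χ (k + 1) (2 * j + 1)) f = halfSqrt * inner ℂ (S.wave S.χ k j) f := by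
    have h1 := hf k j
    have h2 : halfSqrt * halfSqrt = 1 / 2 := by
      rw [halfSqrt, ← Complex.ofReal_mul, ← mul_inv, Real.mul_self_sqrt (by norm_num)]
      norm_num
    rw [wave_haar, inner_smul_left, inner_sub_left, conj_halfSqrt, mul_eq_zero,
      or_iff_right halfSqrt_ne_zero, sub_eq_zero] at h1
    rw [wave_χ k j, inner_smul_left, inner_add_left, conj_halfSqrt, ← mul_assoc, h2, h1]
    constructor <;> ring
  have bound (n : ℕ) : ∀ k j : ℤ, ‖inner ℂ (S.wave S.χ k j) f‖ ≤ ((√2)⁻¹) ^ n * ‖f‖ := by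
    induction n with
    | zero =>
      intro k j
      simpa [norm_wave, S.norm_χ] using norm_inner_le_norm (𝕜 := ℂ) (S.wave S.χ k j) f
    | succ n ih =>
      intro k j
      have h (i : ℤ) (hi : inner ℂ (S.wave S.χ k j) f =
          halfSqrt * inner ℂ (S.wave S.χ (k - 1) i) f) :
          ‖inner ℂ (S.wave S.χ k j) f‖ ≤ ((√2)⁻¹) ^ (n + 1) * ‖f‖ := by
        rw [hi, norm_mul, norm_halfSqrt, pow_succ', mul_assoc]
        gcongr
        exact ih _ _
      obtain ⟨i, rfl | rfl⟩ := j.even_or_odd'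
      · exact h i (by simpa using (key (k - 1) i).1)
      · exact h i (by simpa using (key (k - 1) i).2)
  have hlt : (√2)⁻¹ < 1 := inv_lt_one_of_one_lt₀ (by
    rw [Real.lt_sqrt (by norm_num)]; norm_num)
  have hlim := (tendsto_pow_atTop_nhds_zero_of_lt_one (by positivity) hlt).mul_const ‖f‖
  rw [zero_mul] at hlim
  have := ge_of_tendsto' hlim fun n => bound n k j
  exact norm_le_zero_iff.1 this

theorem isTight_smul {φ : H} {b : ℝ≥0∞} (h : S.IsTight φ b) (c : ℂ) :
    S.IsTight (c • φ) (‖c‖ₑ ^ 2 * b) := by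
  intro f
  rw [mul_assoc, ← h f, ← ENNReal.tsum_mul_left]
  refine tsum_congr fun k => ?_
  unfold energy
  rw [← ENNReal.tsum_mul_left]
  refine tsum_congr fun j => ?_
  rw [wave_smul, inner_smul_left, enorm_mul, mul_pow, RCLike.enorm_conj]

/-! ### Completeness of the Haar system and the classification -/

variable [CompleteSpace H]

theorem topologicalClosure_span_haar : (Submodule.span ℂ
    (Set.range fun p : ℤ × ℤ => S.wave S.haar p.1 p.2)).topologicalClosure = ⊤ := by
  rw [topologicalClosure_span_range_eq_top_iff]
  intro f hf
  refine topologicalClosure_span_range_eq_top_iff.1 S.dense f fun p => ?_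
  have := inner_wave_χ_of_forall_inner_haar (fun k j => hf (k, j)) p.1 p.2
  simpa [wave] using this

theorem isTight_of_orthonormal {φ : H}
    (ho : Orthonormal ℂ fun p : ℤ × ℤ => S.wave φ p.1 p.2)
    (hd : (Submodule.span ℂ
      (Set.range fun p : ℤ × ℤ => S.wave φ p.1 p.2)).topologicalClosure = ⊤) :
    S.IsTight φ 1 := by
  intro f
  rw [one_mul, ← ho.tsum_enorm_inner_sq hd f,
    ENNReal.tsum_prod (f := fun k j => ‖inner ℂ (S.wave φ k j) f‖ₑ ^ 2)]
  rfl

theorem isTight_haar : S.IsTight S.haar 1 :=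
  isTight_of_orthonormal orthonormal_haar topologicalClosure_span_haar

/-- A vector of `K` that is self-similar under halving is a multiple of `χ`. -/
theorem exists_eq_smul_χ {u : H} (hu : u ∈ S.K) (hu0 : u ≠ 0) {a₀ a₁ : ℂ}
    (h : u = S.D (a₀ • u) + S.D (S.T (a₁ • u))) : ∃ r : ℂ, r ≠ 0 ∧ u = r • S.χ := by
  have h₀ : a₀ • u ∈ S.K := S.K.smul_mem _ hu
  have h₁ : a₁ • u ∈ S.K := S.K.smul_mem _ hu
  have ha : ‖a₀‖ₑ ^ 2 + ‖a₁‖ₑ ^ 2 = 1 := by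
    -- Taking norms in the self-similarity equation gives `|a₀|² + |a₁|² = 1`.
    have e := enorm_sq_add_D_T h₀ h₁
    rw [← h, enorm_smul, enorm_smul, mul_pow, mul_pow, ← add_mul] at e
    have hu0' : ‖u‖ₑ ^ 2 ≠ 0 := by simpa using hu0
    exact (ENNReal.mul_left_inj hu0' (enorm_sq_ne_top u)).1 (by rw [one_mul, ← e])
  -- Self-similarity makes the Haar energy of `u` the same at every fine scale; the sum being
  -- finite, this energy is zero.
  have hconst (n : ℕ) : S.energy S.haar n u = S.energy S.haar 0 u := by
    induction n with
    | zero => rfl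
    | succ n ih =>
      conv_lhs => rw [h, ← map_add, Nat.cast_succ]
      rw [energy_add_one_D, energy_add_T haar_mem h₀ h₁, energy_smul, energy_smul, ← add_mul, ha,
        one_mul, ih]
  have hfine : S.fine S.haar u = 0 := by
    have hne := fine_ne_top ENNReal.one_ne_top (isTight_haar (S := S)) u
    simp only [fine, hconst] at hne ⊢
    by_cases h0 : S.energy S.haar 0 u = 0
    · simp [h0]
    · exact absurd (ENNReal.tsum_const_eq_top_of_ne_zero h0) hne
  -- The energy at scale `-(n + 1)` is `2⁻⁽ⁿ⁺¹⁾ |⟨χ, u⟩|²`, and the geometric series sums to one.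
  have hcoarse : S.coarse S.haar u = ‖inner ℂ S.χ u‖ₑ ^ 2 := by
    have e (n : ℕ) {g : H} (hg : g ∈ S.K) :
        inner ℂ S.χ ((S.D ^ n) g) = halfSqrt ^ n * inner ℂ S.χ g := by
      induction n with
      | zero => simp
      | succ n ih =>
        rw [pow_succ', LinearIsometryEquiv.coe_mul, Function.comp_apply,
          inner_χ_D (D_pow_mem hg n), ih, pow_succ', mul_assoc]
    have hs : ‖halfSqrt‖ₑ ^ 2 = 2⁻¹ := by
      rw [enorm_sq_eq_ofReal_norm_sq, norm_halfSqrt_sq, one_div,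
        ENNReal.ofReal_inv_of_pos two_pos]
      simp
    have e2 (n : ℕ) : ‖inner ℂ S.haar ((S.D ^ n) (S.D u))‖ₑ ^ 2 =
        2⁻¹ ^ (n + 1) * ‖inner ℂ S.χ u‖ₑ ^ 2 := by
      have : (S.D ^ n) (S.D u) = S.D ((S.D ^ n) u) := by
        rw [← Function.comp_apply (f := ⇑(S.D ^ n)), ← LinearIsometryEquiv.coe_mul, ← pow_succ,
          pow_succ']
        rfl
      rw [this, inner_haar_D (D_pow_mem hu n), e n hu, enorm_mul, enorm_mul, mul_pow, mul_pow,
        enorm_pow, ← hs]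
      ring
    rw [coarse_eq_tsum haar_mem (S.D_mem _ hu)]
    simp only [e2]
    rw [ENNReal.tsum_mul_right, ENNReal.tsum_geometric_add_one]
    simp [ENNReal.inv_mul_cancel]
  have e := fine_add_coarse (isTight_haar (S := S)) u
  rw [hfine, hcoarse, zero_add, one_mul, enorm_sq_eq_ofReal_norm_sq, enorm_sq_eq_ofReal_norm_sq,
    ENNReal.ofReal_eq_ofReal_iff (by positivity) (by positivity),
    pow_left_inj₀ (by positivity) (by positivity) two_ne_zero] at e
  have hχ0 : S.χ ≠ 0 := by
    rw [← norm_ne_zero_iff, S.norm_χ]; exact one_ne_zero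
  -- Tightness of the Haar system now reads `|⟨χ, u⟩| = ‖u‖`, the equality case of Cauchy–Schwarz
  -- with the unit vector `χ`.
  refine (norm_inner_eq_norm_iff (𝕜 := ℂ) hχ0 hu0).1 ?_
  rw [e, S.norm_χ, one_mul]

theorem exists_eq_smul_haar {ψ : H} {b : ℝ≥0∞} (hψ : ψ ∈ S.K) (hb : b ≠ ∞)
    (ht : S.IsTight ψ b) : ∃ β : ℂ, ψ = β • S.haar := by
  rcases eq_or_ne ψ 0 with rfl | hψ0
  · exact ⟨0, by simp⟩
  obtain ⟨u, hu, hu0, hperp, ⟨a₀, a₁, ha⟩, c₀, c₁, hc⟩ := exists_selfSimilar hψ hψ0 hb ht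
  obtain ⟨r, hr, rfl⟩ := exists_eq_smul_χ hu hu0 ha
  have e : inner ℂ S.χ ψ = (0 : ℂ) := by
    rw [inner_smul_left, mul_eq_zero] at hperp
    exact hperp.resolve_left (by simpa using hr)
  rw [hc, inner_add_right, inner_χ_D (S.K.smul_mem _ hu), inner_χ_D_T (S.K.smul_mem _ hu),
    ← mul_add, mul_eq_zero, or_iff_right halfSqrt_ne_zero] at e
  simp only [inner_smul_right, inner_χ_χ, mul_one, ← add_mul] at e
  have e' : c₁ = -c₀ := by
    rw [eq_neg_iff_add_eq_zero, add_comm]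
    exact (mul_eq_zero.1 e).resolve_right hr
  -- The factor `√2` undoes the normalisation `1/√2` of `haar`.
  refine ⟨c₀ * r * ((√2 : ℝ) : ℂ), ?_⟩
  have hs : c₀ * r * ((√2 : ℝ) : ℂ) * halfSqrt = c₀ * r := by
    rw [mul_assoc, mul_comm ((√2 : ℝ) : ℂ), halfSqrt_mul_sqrt, mul_one]
  rw [hc, haar, smul_smul _ halfSqrt, hs, e']
  simp only [map_smul, map_neg, smul_add, smul_neg, smul_smul, neg_mul, neg_smul, sub_eq_add_neg]

theorem isTight_iff {ψ : H} {b : ℝ≥0∞} (hψ : ψ ∈ S.K) (hb : b ≠ ∞) :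
    S.IsTight ψ b ↔ ∃ β : ℂ, ψ = β • S.haar ∧ ‖β‖ₑ ^ 2 = b := by
  constructor
  · intro ht
    obtain ⟨β, rfl⟩ := exists_eq_smul_haar hψ hb ht
    refine ⟨β, rfl, ?_⟩
    -- The bound is read off by testing both frame identities on the unit vector `χ`.
    have h := isTight_smul (isTight_haar (S := S)) β S.χ
    rw [ht S.χ] at h
    have h1 : ‖S.χ‖ₑ ^ 2 = 1 := by rw [enorm_sq_eq_ofReal_norm_sq, S.norm_χ]; simp
    rw [h1, mul_one, mul_one, mul_one] at h
    exact h.symm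
  · rintro ⟨β, rfl, rfl⟩
    simpa using isTight_smul isTight_haar β

theorem orthonormal_basis_iff {ψ : H} (hψ : ψ ∈ S.K) :
    (Orthonormal ℂ (fun p : ℤ × ℤ => S.wave ψ p.1 p.2) ∧
      (Submodule.span ℂ
        (Set.range fun p : ℤ × ℤ => S.wave ψ p.1 p.2)).topologicalClosure = ⊤) ↔
      ∃ β : ℂ, ‖β‖ = 1 ∧ ψ = β • S.haar := by
  constructor
  · rintro ⟨ho, hd⟩
    obtain ⟨β, rfl, -⟩ := (isTight_iff hψ ENNReal.one_ne_top).1 (isTight_of_orthonormal ho hd)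
    have h := ho.1 0
    rw [norm_wave, norm_smul, norm_haar, mul_one] at h
    exact ⟨β, h, rfl⟩
  · rintro ⟨β, hβ, rfl⟩
    have hβ0 : β ≠ 0 := norm_ne_zero_iff.1 (by rw [hβ]; exact one_ne_zero)
    simp only [wave_smul]
    refine ⟨⟨fun p => ?_, fun p p' hp => ?_⟩,
      topologicalClosure_span_range_eq_top_iff.2 fun f hf => ?_⟩
    · rw [norm_smul, hβ, one_mul]
      exact orthonormal_haar.1 p
    · have h := (orthonormal_haar (S := S)).2 hp
      change inner ℂ (β • S.wave S.haar p.1 p.2) (β • S.wave S.haar p'.1 p'.2) = 0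
      rw [inner_smul_left, inner_smul_right, h, mul_zero, mul_zero]
    · refine topologicalClosure_span_range_eq_top_iff.1 (topologicalClosure_span_haar (S := S)) f
        fun p => ?_
      have := hf p
      rw [inner_smul_left, mul_eq_zero] at this
      exact this.resolve_left (by simpa using hβ0)

end DyadicSystem

/-! ### The dyadic system of `L²(ℝ)` -/

namespace DyadicWavelet

/-- `f` vanishes almost everywhere outside `[a, b]`. -/
def SupportedIn (f : L2R) (a b : ℝ) : Prop := ∀ᵐ x : ℝ, x ∉ Set.Icc a b → f x = 0

theorem ae_comp_add {p : ℝ → Prop} (h : ∀ᵐ x : ℝ, p x) (a : ℝ) : ∀ᵐ x : ℝ, p (x + a) :=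
  (measurePreserving_shift a).quasiMeasurePreserving.ae h

theorem coeFn_translation_symm (f : L2R) : translation.symm f =ᵐ[volume] fun x => f (x + 1) := by
  have h := ae_comp_add (coeFn_translation (translation.symm f)) 1
  rw [LinearIsometryEquiv.apply_symm_apply] at h
  filter_upwards [h] with x hx
  simpa using hx.symm

theorem SupportedIn.translate {f : L2R} {a b : ℝ} (h : SupportedIn f a b) :
    SupportedIn (translation f) (a + 1) (b + 1) := by
  filter_upwards [coeFn_translation f, ae_comp_add h (-1)] with x h1 h2 hx
  rw [h1]
  refine h2 fun hm => hx ?_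
  simp only [Set.mem_Icc] at hm ⊢
  constructor <;> linarith

theorem SupportedIn.translate_symm {f : L2R} {a b : ℝ} (h : SupportedIn f a b) :
    SupportedIn (translation.symm f) (a - 1) (b - 1) := by
  filter_upwards [coeFn_translation_symm f, ae_comp_add h 1] with x h1 h2 hx
  rw [h1]
  refine h2 fun hm => hx ?_
  simp only [Set.mem_Icc] at hm ⊢
  constructor <;> linarith

theorem SupportedIn.translate_zpow {f : L2R} {a b : ℝ} (h : SupportedIn f a b) (j : ℤ) :
    SupportedIn ((translation ^ j) f) (a + j) (b + j) := by
  induction j using Int.induction_on with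
  | zero => simpa
  | succ n ih =>
    rw [add_comm (n : ℤ), zpow_add, zpow_one]
    push_cast at ih ⊢
    rw [add_comm (1 : ℝ), ← add_assoc, ← add_assoc]
    exact ih.translate
  | pred n ih =>
    rw [sub_eq_neg_add, zpow_add, zpow_neg_one, LinearIsometryEquiv.coe_mul, Function.comp_apply,
      LinearIsometryEquiv.coe_inv, ← sub_eq_neg_add]
    push_cast at ih ⊢
    rw [← add_sub_assoc, ← add_sub_assoc]
    exact ih.translate_symm

theorem SupportedIn.dilate {f : L2R} {a b : ℝ} (h : SupportedIn f a b) :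
    SupportedIn (dilation f) (a / 2) (b / 2) := by
  filter_upwards [coeFn_dilation f, (quasiMeasurePreserving_scale two_pos).ae h] with x h1 h2 hx
  rw [h1, h2, mul_zero]
  refine fun hm => hx ?_
  simp only [Set.mem_Icc] at hm ⊢
  constructor <;> linarith

theorem SupportedIn.mono {f : L2R} {a b a' b' : ℝ} (h : SupportedIn f a b) (ha : a' ≤ a)
    (hb : b ≤ b') : SupportedIn f a' b' := by
  filter_upwards [h] with x hx hm
  exact hx fun h' => hm (Set.Icc_subset_Icc ha hb h')

theorem SupportedIn.inner_eq_zero {f g : L2R} {a b c d : ℝ} (hf : SupportedIn f a b)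
    (hg : SupportedIn g c d) (h : b ≤ c) : inner ℂ f g = 0 := by
  rw [L2.inner_def]
  refine integral_eq_zero_of_ae ?_
  -- When `b = c` the closed intervals share the point `b`, which is discarded as a null set.
  filter_upwards [hf, hg, (Set.countable_singleton b).ae_notMem volume] with x h1 h2 h3
  by_cases hx : x ∈ Set.Icc a b
  · rw [h2 fun hx' => h3 (le_antisymm hx.2 (h.trans hx'.1))]
    simp
  · rw [h1 hx]
    simp

theorem translation_dilation (f : L2R) :
    translation (dilation f) = dilation (translation (translation f)) := by
  apply Lp.ext
  have hs := quasiMeasurePreserving_scale two_pos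
  filter_upwards [coeFn_translation (dilation f), ae_comp_add (coeFn_dilation f) (-1),
    coeFn_dilation (translation (translation f)), hs.ae (coeFn_translation (translation f)),
    hs.ae (ae_comp_add (coeFn_translation f) (-1))] with x h1 h2 h3 h4 h5
  rw [← sub_eq_add_neg] at h2 h5
  rw [h1, h2, h3, h4, h5]
  ring_nf

/-- The restriction of `f` to `[0, 1)`. -/
noncomputable def restrictUnit (f : L2R) : L2R :=
  ((Lp.memLp f).indicator (measurableSet_Ico (a := (0 : ℝ)) (b := 1))).toLp _

theorem coeFn_restrictUnit (f : L2R) :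
    restrictUnit f =ᵐ[volume] (Set.Ico (0 : ℝ) 1).indicator f :=
  MemLp.coeFn_toLp _

theorem supportedIn_restrictUnit (f : L2R) : SupportedIn (restrictUnit f) 0 1 := by
  filter_upwards [coeFn_restrictUnit f] with x h1 hx
  rw [h1, Set.indicator_of_notMem fun h => hx (Set.Ico_subset_Icc_self h)]

theorem SupportedIn.eq_restrictUnit_add {g : L2R} (hg : SupportedIn g 0 2) :
    g = restrictUnit g +
      translation (restrictUnit (translation.symm g)) := by
  apply Lp.ext
  -- The half-open cells `[0,1)` and `[1,2)` miss only the point `2` of the closed support, and it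
  -- is removed as a null set.
  filter_upwards [hg, coeFn_restrictUnit g,
    Lp.coeFn_add (restrictUnit g)
      (translation (restrictUnit (translation.symm g))),
    coeFn_translation (restrictUnit (translation.symm g)),
    ae_comp_add (coeFn_restrictUnit (translation.symm g)) (-1),
    ae_comp_add (coeFn_translation_symm g) (-1),
    (Set.countable_singleton (2 : ℝ)).ae_notMem volume] with x h1 h2 h3 h4 h5 h6 h7
  rw [← sub_eq_add_neg] at h5 h6
  rw [h3, Pi.add_apply, h2, h4, h5]
  simp only [Set.indicator, Set.mem_Ico, h6, sub_add_cancel]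
  by_cases hx : x ∈ Set.Icc (0 : ℝ) 2
  · have h2x : x < 2 := lt_of_le_of_ne hx.2 h7
    by_cases hx1 : x < 1
    · rw [if_pos ⟨hx.1, hx1⟩, if_neg fun h => by linarith [h.1], add_zero]
    · rw [if_neg fun h => hx1 h.2, if_pos ⟨by linarith, by linarith⟩, zero_add]
  · simp [h1 hx]

theorem SupportedIn.dilate_symm {f : L2R} (h : SupportedIn f 0 1) :
    SupportedIn (dilation.symm f) 0 2 := by
  have hq := quasiMeasurePreserving_scale (c := 2⁻¹) (by norm_num)
  have h1 := hq.ae (coeFn_dilation (dilation.symm f))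
  rw [LinearIsometryEquiv.apply_symm_apply] at h1
  filter_upwards [h1, hq.ae h] with x h2 h3 hx
  rw [h3, mul_inv_cancel_left₀ two_ne_zero] at h2
  · simpa using h2.symm
  · refine fun hm => hx ?_
    simp only [Set.mem_Icc] at hm ⊢
    constructor <;> linarith

/-- The indicator function of `[a, b)` in `L²(ℝ)`. -/
noncomputable def indicatorIco (a b : ℝ) : L2R :=
  indicatorConstLp 2 (measurableSet_Ico (a := a) (b := b)) (by simp) (1 : ℂ)

theorem coeFn_indicatorIco (a b : ℝ) :
    indicatorIco a b =ᵐ[volume] (Set.Ico a b).indicator fun _ => (1 : ℂ) :=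
  indicatorConstLp_coeFn

theorem translation_indicatorIco (a b : ℝ) :
    translation (indicatorIco a b) = indicatorIco (a + 1) (b + 1) := by
  apply Lp.ext
  filter_upwards [coeFn_translation (indicatorIco a b), ae_comp_add (coeFn_indicatorIco a b) (-1),
    coeFn_indicatorIco (a + 1) (b + 1)] with x h1 h2 h3
  rw [h1, sub_eq_add_neg, h2, h3]
  simp only [Set.indicator, Set.mem_Ico, ← sub_eq_add_neg, le_sub_iff_add_le, sub_lt_iff_lt_add]

theorem translation_zpow_indicatorIco (a b : ℝ) (j : ℤ) :
    (translation ^ j) (indicatorIco a b) = indicatorIco (a + j) (b + j) := by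
  induction j using Int.induction_on with
  | zero => simp
  | succ n ih =>
    rw [add_comm (n : ℤ), zpow_add, zpow_one, LinearIsometryEquiv.coe_mul, Function.comp_apply, ih,
      translation_indicatorIco]
    push_cast
    congr 1 <;> ring
  | pred n ih =>
    rw [sub_eq_neg_add, zpow_add, zpow_neg_one, LinearIsometryEquiv.coe_mul, Function.comp_apply,
      ih, LinearIsometryEquiv.coe_inv, LinearIsometryEquiv.symm_apply_eq, translation_indicatorIco]
    push_cast
    congr 1 <;> ring

theorem dilation_indicatorIco (a b : ℝ) :
    dilation (indicatorIco a b) = ((√2 : ℝ) : ℂ) • indicatorIco (a / 2) (b / 2) := by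
  apply Lp.ext
  filter_upwards [coeFn_dilation (indicatorIco a b),
    (quasiMeasurePreserving_scale two_pos).ae (coeFn_indicatorIco a b),
    Lp.coeFn_smul ((√2 : ℝ) : ℂ) (indicatorIco (a / 2) (b / 2)),
    coeFn_indicatorIco (a / 2) (b / 2)] with x h1 h2 h3 h4
  rw [h1, h2, h3, Pi.smul_apply, h4, smul_eq_mul]
  simp only [Set.indicator, Set.mem_Ico, div_le_iff₀' (two_pos (α := ℝ)),
    lt_div_iff₀' (two_pos (α := ℝ))]

theorem dilation_pow_indicatorIco (a b : ℝ) (n : ℕ) :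
    (dilation ^ n) (indicatorIco a b) =
      ((√2 : ℝ) : ℂ) ^ n • indicatorIco (a / 2 ^ n) (b / 2 ^ n) := by
  induction n with
  | zero => simp
  | succ n ih =>
    rw [pow_succ', LinearIsometryEquiv.coe_mul, Function.comp_apply, ih, map_smul,
      dilation_indicatorIco, smul_smul, div_div, div_div, pow_succ, pow_succ]

theorem indicatorIco_add {a b c : ℝ} (hab : a ≤ b) (hbc : b ≤ c) :
    indicatorIco a b + indicatorIco b c = indicatorIco a c := by
  apply Lp.ext
  filter_upwards [Lp.coeFn_add (indicatorIco a b) (indicatorIco b c), coeFn_indicatorIco a b,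
    coeFn_indicatorIco b c, coeFn_indicatorIco a c] with x h h1 h2 h3
  rw [h, Pi.add_apply, h1, h2, h3, ← Set.Ico_union_Ico_eq_Ico hab hbc,
    Set.indicator_union_of_disjoint (by
      rw [Set.disjoint_left]; exact fun x hx hx' => absurd hx.2 (not_lt.2 hx'.1))]

theorem locallyIntegrable_coeFn (f : L2R) : LocallyIntegrable f volume :=
  (Lp.memLp f).locallyIntegrable one_le_two

theorem intervalIntegrable_coeFn (f : L2R) (a b : ℝ) : IntervalIntegrable f volume a b :=
  ((locallyIntegrable_coeFn f).integrableOn_isCompact isCompact_uIcc).intervalIntegrable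

theorem inner_indicatorIco {a b : ℝ} (hab : a ≤ b) (f : L2R) :
    inner ℂ (indicatorIco a b) f = ∫ x in a..b, f x := by
  rw [indicatorIco, L2.inner_indicatorConstLp_one, integral_Ico_eq_integral_Ioc,
    intervalIntegral.integral_of_le hab]

/-- By Lebesgue differentiation `f` is almost everywhere the derivative of its primitive. -/
theorem eq_zero_of_forall_intervalIntegral_eq_zero {f : L2R}
    (h : ∀ x : ℝ, ∫ t in (0 : ℝ)..x, f t = 0) : f = 0 := by
  apply Lp.ext
  filter_upwards [LocallyIntegrable.ae_hasDerivAt_integral (locallyIntegrable_coeFn f), Lp.coeFn_zero ℂ 2 volume]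
    with x hx h0
  rw [h0]
  have h1 := hx 0
  simp only [h] at h1
  simpa using h1.unique (hasDerivAt_const x 0)

/-- The primitive of `f` vanishes at every dyadic rational, by adding up adjacent intervals from
`0`, and it is continuous, so it vanishes identically. -/
theorem eq_zero_of_forall_inner_dyadic {f : L2R}
    (h : ∀ (n : ℕ) (j : ℤ), inner ℂ (indicatorIco (j / 2 ^ n) ((j + 1) / 2 ^ n)) f = 0) :
    f = 0 := by
  refine eq_zero_of_forall_intervalIntegral_eq_zero fun x => ?_
  have hstep (n : ℕ) (j : ℤ) : ∫ t in (j / 2 ^ n : ℝ)..((j + 1) / 2 ^ n), f t = 0 := by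
    rw [← h n j, inner_indicatorIco (by gcongr; linarith)]
  have hdy (n : ℕ) (j : ℤ) : ∫ t in (0 : ℝ)..(j / 2 ^ n), f t = 0 := by
    induction j using Int.induction_on with
    | zero => simp
    | succ i ih =>
      have h1 := hstep n i
      have h2 := intervalIntegral.integral_add_adjacent_intervals
        (intervalIntegrable_coeFn f 0 (((i : ℤ) : ℝ) / 2 ^ n))
        (intervalIntegrable_coeFn f _ ((((i : ℤ) : ℝ) + 1) / 2 ^ n))
      rw [ih, h1, add_zero] at h2
      push_cast at h2 ⊢
      exact h2.symm
    | pred i ih =>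
      have h1 := hstep n (-i - 1)
      have h2 := intervalIntegral.integral_add_adjacent_intervals
        (intervalIntegrable_coeFn f 0 (((-i - 1 : ℤ) : ℝ) / 2 ^ n))
        (intervalIntegrable_coeFn f _ ((((-i - 1 : ℤ) : ℝ) + 1) / 2 ^ n))
      rw [h1, add_zero] at h2
      rw [h2, ← ih]
      push_cast
      ring_nf
  have hcont : Continuous fun y => ∫ t in (0 : ℝ)..y, f t :=
    intervalIntegral.continuous_primitive (intervalIntegrable_coeFn f) 0
  have hlim : Filter.Tendsto (fun n : ℕ => ((⌊x * 2 ^ n⌋ : ℤ) : ℝ) / 2 ^ n) Filter.atTop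
      (nhds x) := by
    have h0 := tendsto_pow_atTop_nhds_zero_of_lt_one (r := (2 : ℝ)⁻¹) (by norm_num) (by norm_num)
    have h1 := h0.const_sub x
    rw [sub_zero] at h1
    refine tendsto_of_tendsto_of_tendsto_of_le_of_le h1 tendsto_const_nhds (fun n => ?_)
      fun n => ?_
    · have hp : (0 : ℝ) < 2 ^ n := by positivity
      simp only [le_div_iff₀ hp, sub_mul, inv_pow, inv_mul_cancel₀ hp.ne']
      exact (Int.sub_one_lt_floor _).le
    · have hp : (0 : ℝ) < 2 ^ n := by positivity
      simp only [div_le_iff₀ hp]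
      exact Int.floor_le _
  have h1 := (hcont.tendsto x).comp hlim
  simp only [Function.comp_def, hdy] at h1
  exact tendsto_nhds_unique h1 tendsto_const_nhds

/-- `L²(ℝ)` with dyadic dilation, integer translation and the unit interval. -/
noncomputable def unitIntervalSystem : DyadicSystem L2R where
  D := dilation
  T := translation
  K :=
    { carrier := L2UnitInterval
      add_mem' := fun {f g} hf hg => by
        filter_upwards [hf, hg, Lp.coeFn_add f g] with x h1 h2 h3 hx
        rw [h3, Pi.add_apply, h1 hx, h2 hx, add_zero]
      zero_mem' := by
        filter_upwards [Lp.coeFn_zero ℂ 2 volume] with x h _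
        rw [h, Pi.zero_apply]
      smul_mem' := fun c f hf => by
        filter_upwards [hf, Lp.coeFn_smul c f] with x h1 h2 hx
        rw [h2, Pi.smul_apply, h1 hx, smul_zero] }
  χ := indicatorIco 0 1
  T_D := translation_dilation
  D_mem f hf := (SupportedIn.dilate hf).mono (by norm_num) (by norm_num)
  D_T_mem f hf := (SupportedIn.translate hf).dilate.mono (by norm_num) (by norm_num)
  inner_zpow_T j hj f hf g hg := by
    have h := SupportedIn.translate_zpow hf j
    rcases lt_or_gt_of_ne hj with hj | hj
    · refine h.inner_eq_zero hg ?_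
      have : (j : ℝ) ≤ -1 := by exact_mod_cast Int.le_sub_one_of_lt hj
      linarith
    · rw [inner_eq_zero_symm]
      refine SupportedIn.inner_eq_zero hg h ?_
      have : (1 : ℝ) ≤ j := by exact_mod_cast hj
      linarith
  exists_eq_add f hf := by
    refine ⟨_, supportedIn_restrictUnit (dilation.symm f), _,
      supportedIn_restrictUnit (translation.symm (dilation.symm f)), ?_⟩
    rw [← map_add, ← (SupportedIn.dilate_symm hf).eq_restrictUnit_add,
      LinearIsometryEquiv.apply_symm_apply]
  χ_mem := by
    filter_upwards [coeFn_indicatorIco 0 1] with x h hx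
    rw [h, Set.indicator_of_notMem fun h => hx (Set.Ico_subset_Icc_self h)]
  norm_χ := by
    rw [indicatorIco, norm_indicatorConstLp (by simp) (by simp)]
    simp
  refinement := by
    rw [translation_indicatorIco, dilation_indicatorIco, dilation_indicatorIco, ← smul_add, zero_div,
      zero_add, indicatorIco_add (by norm_num) (by norm_num), add_self_div_two]
  dense := by
    rw [topologicalClosure_span_range_eq_top_iff]
    intro f hf
    refine eq_zero_of_forall_inner_dyadic fun n j => ?_
    have h := hf (n, j)
    rw [translation_zpow_indicatorIco, dilation_pow_indicatorIco, inner_smul_left, mul_eq_zero]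
      at h
    have h2 := h.resolve_left (by simp)
    simpa [add_comm] using h2

theorem haar_unitIntervalSystem : unitIntervalSystem.haar = haarWavelet := by
  change DyadicSystem.halfSqrt • (dilation (indicatorIco 0 1) -
    dilation (translation (indicatorIco 0 1))) = indicatorIco 0 (1 / 2) - indicatorIco (1 / 2) 1
  rw [translation_indicatorIco, dilation_indicatorIco, dilation_indicatorIco, ← smul_sub,
    smul_smul, DyadicSystem.halfSqrt_mul_sqrt, one_smul]
  norm_num

theorem isTightWaveletFrame_singleton_iff (ψ : L2R) {B : ℝ} (hB : 0 < B) :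
    IsTightWaveletFrame {ψ} B ↔ unitIntervalSystem.IsTight ψ (ENNReal.ofReal B) := by
  have h (f : L2R) : ∑' φ : ({ψ} : Set L2R), ∑' k : ℤ, ∑' j : ℤ,
      ENNReal.ofReal (‖inner ℂ (waveletElement (φ : L2R) k j) f‖ ^ 2) =
      ∑' k : ℤ, unitIntervalSystem.energy ψ k f := by
    rw [tsum_singleton ψ fun φ => ∑' k : ℤ, ∑' j : ℤ,
      ENNReal.ofReal (‖inner ℂ (waveletElement φ k j) f‖ ^ 2)]
    simp only [← enorm_sq_eq_ofReal_norm_sq]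
    rfl
  have h2 (f : L2R) : ENNReal.ofReal (B * ‖f‖ ^ 2) = ENNReal.ofReal B * ‖f‖ₑ ^ 2 := by
    rw [ENNReal.ofReal_mul hB.le, enorm_sq_eq_ofReal_norm_sq]
  simp only [IsTightWaveletFrame, IsWaveletFrame, h, h2, hB, true_and, DyadicSystem.IsTight]
  exact forall_congr' fun f => ⟨fun ⟨h1, h2⟩ => le_antisymm h2 h1, fun h => ⟨h.ge, h.le⟩⟩

end DyadicWavelet

theorem corollary3p5 (ψ : DyadicWavelet.L2R) (hψ : ψ ∈ DyadicWavelet.L2UnitInterval) :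
    (∀ B : ℝ, 0 < B →
      (DyadicWavelet.IsTightWaveletFrame {ψ} B ↔
        ∃ β : ℂ, ψ = β • DyadicWavelet.haarWavelet ∧ ‖β‖ ^ 2 = B)) ∧
    (DyadicWavelet.IsOrthonormalWavelet ψ ↔
      ∃ β : ℂ, ‖β‖ = 1 ∧ ψ = β • DyadicWavelet.haarWavelet) := by
  rw [← DyadicWavelet.haar_unitIntervalSystem]
  refine ⟨fun B hB => ?_,
    DyadicSystem.orthonormal_basis_iff (S := DyadicWavelet.unitIntervalSystem) hψ⟩
  rw [DyadicWavelet.isTightWaveletFrame_singleton_iff ψ hB,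
    DyadicSystem.isTight_iff (S := DyadicWavelet.unitIntervalSystem) hψ ENNReal.ofReal_ne_top]
  refine exists_congr fun β => and_congr_right fun _ => ?_
  rw [enorm_sq_eq_ofReal_norm_sq, ENNReal.ofReal_eq_ofReal_iff (by positivity) hB.le]
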